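/- Equip $\{0,1\}^{\mathbb N}$ with the standard product (fair coin) measure. Let $\mathfrak p$ be the minimal cardinality of a family of infinite subsets of $\mathbb N$ that is centered (all finite intersections are infinite) and has no pseudointersection (an infinite set $a$ such that $a\setminus b$ is finite for all $b$ in the family). Let $\mathfrak b$ be the minimal cardinality of a family $F$ of increasing functions $\mathbb N\to\mathbb N$ that is unbounded, i.e. for every increasing $g\colon\mathbb N\to\mathbb N$ there is $f\in F$ with $f(n)>g(n)$ for infinitely many $n$. Let $\mathrm{non}(\mathcal N)$ be the minimal cardinality of a subset of $\{0,1\}^{\mathbb N}$ that is not null. A cover of a topological space is a family of proper subsets whose union is the space. A cover is an $\omega$-cover if every finite subset of the space is contained in a member of the cover, and a $\gamma$-cover if it is infinite and every point belongs to all but finitely many of its members. A space has property $\gamma$ if every $\omega$-cover by open sets contains a $\gamma$-cover. A set $X\subseteq\mathbb R$ is null-additive if $X+N=\{x+y: x\in X,\ y\in N\}$ is Lebesgue null for every Lebesgue null set $N\subseteq\mathbb R$. Theorem. Assume that $\mathfrak p=\mathfrak b\ge\mathrm{non}(\mathcal N)$. Then there is a set $X\subseteq\mathbb R$ that is nontrivial,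 i.e. of cardinality at least $\mathfrak p$, has property $\gamma$ (in the subspace topology), and is not null-additive. -/

import Mathlib

open Set MeasureTheory
open scoped Pointwise Cardinal

/-- A family of sets of natural numbers is centered if all its finite intersections are infinite. -/
def IsCentered (F : Set (Set ℕ)) : Prop :=
  ∀ s ⊆ F, s.Finite → (⋂₀ s).Infinite

/-- An infinite set `a` is a pseudointersection of `F` if `a \ b` is finite for all `b ∈ F`. -/
def IsPseudointersection (a : Set ℕ) (F : Set (Set ℕ)) : Prop :=
  a.Infinite ∧ ∀ b ∈ F, (a \ b).Finite

/-- The pseudointersection number `𝔭`: the minimal cardinality of a family of infinite subsets of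
`ℕ` that is centered and has no pseudointersection. -/
noncomputable def cardP : Cardinal.{0} :=
  sInf {κ | ∃ F : Set (Set ℕ), (∀ a ∈ F, a.Infinite) ∧ IsCentered F ∧
    (¬ ∃ a, IsPseudointersection a F) ∧ #F = κ}

/-- The set of increasing functions `ℕ → ℕ`; infinite subsets of `ℕ` are identified with their
increasing enumerations. -/
def increasingFunctions : Set (ℕ → ℕ) := {f | StrictMono f}

/-- `F` is unbounded if for every increasing `g` there is `f ∈ F` such that `f ≤* g` fails,
i.e. `f n > g n` for infinitely many `n`. -/
def IsUnbounded (F : Set (ℕ → ℕ)) : Prop :=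
  ∀ g ∈ increasingFunctions, ∃ f ∈ F, ¬ {n | g n < f n}.Finite

/-- The bounding number `𝔟`: the minimal cardinality of an unbounded family of increasing
functions. -/
noncomputable def cardB : Cardinal.{0} :=
  sInf {κ | ∃ F : Set (ℕ → ℕ), F ⊆ increasingFunctions ∧ IsUnbounded F ∧ #F = κ}

/-- The standard (fair coin tossing, i.e. normalized Haar) measure on the Cantor cube. -/
noncomputable def cantorMeasure : Measure (ℕ → Bool) :=
  Measure.infinitePi fun _ : ℕ => (PMF.uniformOfFintype Bool).toMeasure

/-- `non(𝒩)`: the minimal cardinality of a subset of the Cantor cube that is not null. -/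
noncomputable def cardNonNull : Cardinal.{0} :=
  sInf {κ | ∃ Z : Set (ℕ → Bool), cantorMeasure Z ≠ 0 ∧ #Z = κ}

/-- A cover of a space: a family of proper subsets whose union is the whole space. -/
def IsProperCover {S : Type*} (U : Set (Set S)) : Prop :=
  (∀ u ∈ U, u ≠ univ) ∧ ⋃₀ U = univ

/-- An `ω`-cover: each finite subset of the space is contained in a member of the cover. -/
def IsOmegaCover {S : Type*} (U : Set (Set S)) : Prop :=
  IsProperCover U ∧ ∀ F : Set S, F.Finite → ∃ u ∈ U, F ⊆ u

/-- A `γ`-cover: an infinite cover such that each point belongs to all but finitely many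
members. -/
def IsGammaCover {S : Type*} (U : Set (Set S)) : Prop :=
  IsProperCover U ∧ U.Infinite ∧ ∀ x : S, {u ∈ U | x ∉ u}.Finite

/-- The property `γ`: every open `ω`-cover of the space contains a `γ`-cover. -/
def HasPropertyGamma (S : Type*) [TopologicalSpace S] : Prop :=
  ∀ U : Set (Set S), (∀ u ∈ U, IsOpen u) → IsOmegaCover U → ∃ V ⊆ U, IsGammaCover V

/-- A subset `X` of the real line is null-additive if `X + N` is null for every null set `N`. -/
def IsNullAdditive (X : Set ℝ) : Prop :=
  ∀ N : Set ℝ, volume N = 0 → volume (X + N) = 0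

open Filter Topology

/-! From `𝔭 = 𝔟`, build a `⊆*`-decreasing unbounded tower of length `𝔟`, and replace each number `n`
by the block of digits between consecutive squares to get sets `T α`. Enumerate a non-null set as `z
α`, `α < 𝔟`. The set `X` consists of the reals coded by finite sets, by `T α`, and by `y α`, the
restriction of `z α` to `T α`.

`X` is not null-additive: `z α` is `y α` plus a sequence vanishing on infinitely many blocks. The
blocks grow, so by Borel–Cantelli such sequences form a null set `N`, and `X + N` contains all `z
α`.

`X` has `γ` (`hasPropertyGamma_of_tower`): fewer than `𝔭` points can be handled by a
pseudointersection, and a cover member containing all points supported below `k` contains every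
point vanishing on some `[k, h k)`. Unboundedness makes some `T α` miss infinitely many such
intervals. Iterating `ω` times and taking the supremum `α`, points below `α` are handled by a bound
for fewer than `𝔟` functions, later ones by vanishing on the intervals. -/

theorem mk_Iio_toType_lt {c : Cardinal.{0}} (i : c.ord.ToType) : #(Iio i) < c := by
  simpa using Cardinal.mk_Iio_lt i (by simp)

/-! ### Basic facts on `𝔭` and `𝔟` -/

theorem exists_pseudointersection_of_lt {F : Set (Set ℕ)} (hF : #F < cardP)
    (hinf : ∀ a ∈ F, a.Infinite) (hc : IsCentered F) : ∃ a, IsPseudointersection a F := by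
  by_contra h
  exact notMem_of_lt_csInf' hF ⟨F, hinf, hc, h, rfl⟩

theorem strictMono_sum_add (f : ℕ → ℕ) :
    StrictMono fun n => ∑ i ∈ Finset.range (n + 1), f i + n := by
  refine strictMono_nat_of_lt_succ fun n => ?_
  rw [Finset.sum_range_succ _ (n + 1)]
  omega

theorem le_sum_add (f : ℕ → ℕ) (n : ℕ) : f n ≤ ∑ i ∈ Finset.range (n + 1), f i + n :=
  (Finset.single_le_sum (f := f) (fun _ _ => Nat.zero_le _) (by simp)).trans (Nat.le_add_right _ _)

theorem exists_unbounded_card_eq :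
    ∃ F : Set (ℕ → ℕ), F ⊆ increasingFunctions ∧ IsUnbounded F ∧ #F = cardB := by
  refine csInf_mem (s := {κ | ∃ F : Set (ℕ → ℕ), F ⊆ increasingFunctions ∧ IsUnbounded F ∧ #F = κ})
    ⟨_, increasingFunctions, subset_rfl, fun g hg => ⟨fun n => g n + 1, ?_, ?_⟩, rfl⟩
  · exact fun a b h => Nat.add_lt_add_right (hg h) 1
  · simpa using infinite_univ

/-- Partial sums give increasing majorants, so the definition of `𝔟` also bounds families of
arbitrary functions. -/
theorem exists_bound_of_lt_cardB {ι : Type} (hι : #ι < cardB) (f : ι → ℕ → ℕ) :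
    ∃ g : ℕ → ℕ, ∀ a, ∀ᶠ n in atTop, f a n ≤ g n := by
  have hF : #(range fun a n => ∑ i ∈ Finset.range (n + 1), f a i + n) < cardB :=
    Cardinal.mk_range_le.trans_lt hι
  have h : ¬ IsUnbounded (range fun a n => ∑ i ∈ Finset.range (n + 1), f a i + n) := fun h =>
    notMem_of_lt_csInf' hF ⟨_, range_subset_iff.2 fun a => strictMono_sum_add (f a), h, rfl⟩
  simp only [IsUnbounded] at h
  push Not at h
  obtain ⟨g, -, h⟩ := h
  refine ⟨g, fun a => ?_⟩
  have := (h _ (mem_range_self a)).eventually_cofinite_notMem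
  rw [Nat.cofinite_eq_atTop] at this
  filter_upwards [this] with n hn
  simp only [not_lt] at hn
  exact (le_sum_add (f a) n).trans hn

/-- Diagonal argument: the function summing the first `n + 1` members at `n` eventually bounds every
member of a countable family. -/
theorem aleph0_lt_cardB : ℵ₀ < cardB := by
  obtain ⟨F, hF, hu, hc⟩ := exists_unbounded_card_eq
  rw [← hc, Cardinal.aleph0_lt_mk_iff, ← not_countable_iff]
  intro hcount
  have hne : F.Nonempty := by
    obtain ⟨f, hf, -⟩ := hu id strictMono_id
    exact ⟨f, hf⟩
  obtain ⟨f, rfl⟩ := (Set.countable_coe_iff.1 hcount).exists_eq_range hne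
  obtain ⟨_, ⟨a, rfl⟩, ha⟩ := hu _ (strictMono_sum_add fun n => ∑ a ∈ Finset.range (n + 1), f a n)
  refine ha ((finite_lt_nat a).subset fun n hn => ?_)
  by_contra han
  refine absurd (mem_ofPred_eq ▸ hn) (not_lt.2 ?_)
  refine le_trans ?_ (le_sum_add _ n)
  exact Finset.single_le_sum (f := fun a => f a n) (fun _ _ => Nat.zero_le _)
    (Finset.mem_range.2 (Nat.lt_succ_of_le (not_lt.1 han)))

/-! ### Unbounded towers -/

theorem exists_strictMono_mem_ge {a : Set ℕ} (ha : a.Infinite) (u : ℕ → ℕ) :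
    ∃ f : ℕ → ℕ, StrictMono f ∧ (∀ n, f n ∈ a) ∧ ∀ n, u n ≤ f n := by
  obtain ⟨f, hf, h⟩ := extraction_forall_of_frequently (P := fun n k => k ∈ a ∧ u n ≤ k)
    fun n => (Nat.frequently_atTop_iff_infinite.2 ha).and_eventually (eventually_ge_atTop _)
  exact ⟨f, hf, fun n => (h n).1, fun n => (h n).2⟩

/-- Under `𝔭 = 𝔟` there is an unbounded tower of length `𝔟`. -/
theorem exists_unbounded_tower (hpb : cardP = cardB) :
    ∃ f : cardB.ord.ToType → ℕ → ℕ, (∀ α, StrictMono (f α)) ∧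
      (∀ α β, α ≤ β → (range (f β) \ range (f α)).Finite) ∧
      ∀ g : ℕ → ℕ, ∃ α, ∃ᶠ n in atTop, g n < f α n := by
  obtain ⟨F, hF, hu, hc⟩ := exists_unbounded_card_eq
  obtain ⟨e⟩ : Nonempty (cardB.ord.ToType ≃ F) := by
    rw [← Cardinal.eq, hc, Cardinal.mk_ord_toType]
  let P (α : cardB.ord.ToType) (p : ∀ β, β < α → ℕ → ℕ) (f : ℕ → ℕ) : Prop :=
    StrictMono f ∧ (∀ n, (e α : ℕ → ℕ) n ≤ f n) ∧ ∀ β h, (range f \ range (p β h)).Finite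
  classical
  -- The default `id` is never taken: `key` shows that each stage of the recursion has a solution.
  let f : cardB.ord.ToType → ℕ → ℕ := WellFounded.fix wellFounded_lt
    fun α p => if h : ∃ f, P α p f then h.choose else id
  have hf : ∀ α, f α = if h : ∃ g, P α (fun β _ => f β) g then h.choose else id :=
    fun α => WellFounded.fix_eq _ _ _
  have key : ∀ α, P α (fun β _ => f β) (f α) := by
    intro α
    induction α using WellFoundedLT.induction with
    | _ α ih =>
    have hex : ∃ g, P α (fun β _ => f β) g := by
      have hdec : ∀ β γ, β ≤ γ → γ < α → (range (f γ) \ range (f β)).Finite := by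
        intro β γ hβγ hγ
        rcases hβγ.eq_or_lt with rfl | h
        · simp
        · exact (ih γ hγ).2.2 β h
      obtain ⟨a, ha, ha'⟩ := exists_pseudointersection_of_lt
        (F := (fun β => range (f β)) '' Iio α)
        (by rw [hpb]; exact Cardinal.mk_image_le.trans_lt (mk_Iio_toType_lt α))
        (by
          rintro _ ⟨β, hβ, rfl⟩
          exact infinite_range_of_injective (ih β hβ).1.injective)
        (by
          intro s hs hfin
          obtain ⟨t, ht, htf, rfl⟩ := exists_subset_image_finite_and.1 ⟨s, hs, hfin, rfl⟩ 
          rcases t.eq_empty_or_nonempty with rfl | hne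
          · simpa using infinite_univ
          -- The range with the largest index is almost contained in the others, so the intersection
          -- loses only finitely many of its points.
          obtain ⟨γ, hγ, hmax⟩ := htf.exists_maximal hne
          have hsub : range (f γ) \ ⋃ β ∈ t, (range (f γ) \ range (f β)) ⊆
              ⋂₀ ((fun β => range (f β)) '' t) := by
            rintro x ⟨hx, hx'⟩
            simp only [mem_iUnion, not_exists] at hx'
            rintro _ ⟨β, hβ, rfl⟩
            by_contra hxb
            exact hx' β hβ ⟨hx, hxb⟩
          refine Set.Infinite.mono hsub (Set.Infinite.sdiff
            (infinite_range_of_injective (ih γ (ht hγ)).1.injective) (htf.biUnion fun β hβ => ?_))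
          refine hdec β γ ?_ (ht hγ)
          rcases le_total β γ with h | h
          · exact h
          · exact hmax hβ h)
      obtain ⟨g, hg, hga, hgu⟩ := exists_strictMono_mem_ge ha (e α)
      refine ⟨g, hg, hgu, fun β hβ => (ha' _ (mem_image_of_mem _ hβ)).subset ?_⟩
      exact sdiff_subset_sdiff_left (range_subset_iff.2 hga)
    rw [hf α, dif_pos hex]
    exact hex.choose_spec
  refine ⟨f, fun α => (key α).1, fun α β hαβ => ?_, fun g => ?_⟩
  · rcases hαβ.eq_or_lt with rfl | h
    · simp
    · exact (key β).2.2 α h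
  · obtain ⟨u, hu, hg⟩ := hu _ (strictMono_sum_add g)
    obtain ⟨α, rfl⟩ : ∃ α, (e α : ℕ → ℕ) = u := ⟨e.symm ⟨u, hu⟩, by simp⟩
    refine ⟨α, Nat.frequently_atTop_iff_infinite.2 (Set.Infinite.mono ?_ hg)⟩
    intro n hn
    exact ((le_sum_add g n).trans_lt hn).trans_le ((key α).2.1 n)

/-- This is the uncountable cofinality of `𝔟`: were the `a n` cofinal, bounding each initial segment
and then the countably many bounds would bound the whole family. -/
theorem exists_upper_bound_of_unbounded (f : cardB.ord.ToType → ℕ → ℕ)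
    (hf : ∀ g : ℕ → ℕ, ∃ α, ∃ᶠ n in atTop, g n < f α n) (a : ℕ → cardB.ord.ToType) :
    ∃ α, ∀ n, a n ≤ α := by
  by_contra! h
  choose g hg using fun n => exists_bound_of_lt_cardB (ι := Iio (a n))
    (mk_Iio_toType_lt (a n)) (fun β => f β)
  obtain ⟨g', hg'⟩ := exists_bound_of_lt_cardB (ι := ℕ) (by simpa using aleph0_lt_cardB) g
  obtain ⟨α, hα⟩ := hf g'
  obtain ⟨n, hn⟩ := h α
  refine hα ?_
  filter_upwards [hg n ⟨α, hn⟩, hg' n] with k h1 h2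
  exact not_lt.2 (h1.trans h2)

/-- A strictly increasing function that meets almost all intervals `[k, h k)` is bounded by a
function depending on `h` only. -/
theorem exists_forall_frequently_disjoint (h : ℕ → ℕ) :
    ∃ g : ℕ → ℕ, ∀ f : ℕ → ℕ, StrictMono f → (∃ᶠ n in atTop, g n < f n) →
      ∃ᶠ k in atTop, Disjoint (range f) (Ico k (h k)) := by
  let H : ℕ → ℕ := fun k => ∑ i ∈ Finset.range (k + 1), h (i + 1) + k + 1
  have hmono : StrictMono H := fun a b hab =>
    Nat.add_lt_add_right (strictMono_sum_add (fun i => h (i + 1)) hab) 1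
  have hle : ∀ k, h (k + 1) ≤ H k := fun k =>
    (le_sum_add (fun i => h (i + 1)) k).trans (Nat.le_succ _)
  have hlt : ∀ k, k + 1 ≤ H k := fun k => by simp only [H]; omega
  have hiter : StrictMono fun n => H^[n] 0 := by
    refine strictMono_nat_of_lt_succ fun n => ?_
    rw [Function.iterate_succ_apply']
    exact hlt _
  -- If `f` meets all late intervals, each step costs one application of `H`. The start `f K` costs
  -- at most `f K` more, and the factor 2 absorbs this.
  refine ⟨fun n => H^[2 * n] 0, fun f hf hfreq hcon => hfreq ?_⟩
  obtain ⟨K, hK⟩ := eventually_atTop.1 hcon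
  have hstep : ∀ n, f (K + n) ≤ H^[n] (f K) := by
    intro n
    induction n with
    | zero => simp
    | succ n ih =>
      rw [Function.iterate_succ_apply']
      refine le_trans ?_ (hmono.monotone ih)
      -- Starting the interval just after `f (K + n)` forces a later value of `f` into it.
      have h1 := hK (f (K + n) + 1) ((Nat.le_add_right K n).trans (hf.le_apply.trans (Nat.le_succ _)))
      obtain ⟨_, ⟨m, rfl⟩, hm1, hm2⟩ := not_disjoint_iff.1 h1
      have : K + n < m := hf.lt_iff_lt.1 hm1
      exact (hf.monotone (show K + (n + 1) ≤ m by omega)).trans (hm2.le.trans (hle _))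
  filter_upwards [eventually_ge_atTop (K + f K)] with n hn
  obtain ⟨m, rfl⟩ := Nat.exists_eq_add_of_le ((Nat.le_add_right _ _).trans hn : K ≤ n)
  refine not_lt.2 ((hstep m).trans ?_)
  calc H^[m] (f K) ≤ H^[m] (H^[f K] 0) := (hmono.monotone.iterate m) (hiter.le_apply)
    _ = H^[m + f K] 0 := by rw [Function.iterate_add_apply]
    _ ≤ _ := hiter.monotone (by omega)

/-! ### Property `γ` and sequences of cover members -/

/-- The range is automatically infinite: otherwise one member recurs infinitely often, hence
contains every point, against properness. -/
theorem hasPropertyGamma_of_exists_seq {S : Type*} [TopologicalSpace S]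
    (h : ∀ U : Set (Set S), (∀ u ∈ U, IsOpen u) → IsOmegaCover U →
      ∃ u : ℕ → Set S, (∀ n, u n ∈ U) ∧ ∀ x, ∀ᶠ n in atTop, x ∈ u n) : HasPropertyGamma S := by
  intro U hU hω
  obtain ⟨u, huU, hu⟩ := h U hU hω
  refine ⟨range u, range_subset_iff.2 huU, ⟨?_, ?_⟩, ?_, fun x => ?_⟩
  · rintro _ ⟨n, rfl⟩
    exact hω.1.1 _ (huU n)
  · refine eq_univ_of_forall fun x => ?_
    obtain ⟨n, hn⟩ := (hu x).exists
    exact ⟨_, mem_range_self n, hn⟩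
  · intro hfin
    obtain ⟨n, hn⟩ : ∃ n, ∃ᶠ m in atTop, u m = u n := by
      by_contra! hcon
      have : ∀ᶠ m in atTop, ∀ v ∈ range u, u m ≠ v := by
        refine (eventually_all_finite hfin).2 ?_
        rintro _ ⟨n, rfl⟩
        exact hcon n
      obtain ⟨m, hm⟩ := this.exists
      exact hm _ (mem_range_self m) rfl
    refine hω.1.1 _ (huU n) (eq_univ_of_forall fun x => ?_)
    obtain ⟨m, hm, hx⟩ := (hn.and_eventually (hu x)).exists
    exact hm ▸ hx
  · have := hu x
    rw [← Nat.cofinite_eq_atTop] at this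
    refine (Set.Finite.image u (eventually_cofinite.1 this)).subset ?_
    rintro _ ⟨⟨n, rfl⟩, hx⟩
    exact ⟨n, hx, rfl⟩

theorem Homeomorph.hasPropertyGamma {S S' : Type*} [TopologicalSpace S] [TopologicalSpace S']
    (e : S ≃ₜ S') (h : HasPropertyGamma S) : HasPropertyGamma S' := by
  refine hasPropertyGamma_of_exists_seq fun U hU hω => ?_
  have hpre : Function.Injective (preimage e) := preimage_injective.2 e.surjective
  obtain ⟨V, hV, ⟨hV1, hV2, hV3⟩⟩ := h (preimage e '' U)
    (by
      rintro _ ⟨u, hu, rfl⟩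
      exact (hU u hu).preimage e.continuous)
    (by
      refine ⟨⟨?_, ?_⟩, fun F hF => ?_⟩
      · rintro _ ⟨u, hu, rfl⟩ h
        exact hω.1.1 u hu (hpre (by rw [h, preimage_univ]))
      · rw [sUnion_image, ← preimage_iUnion₂, ← sUnion_eq_biUnion, hω.1.2, preimage_univ]
      · obtain ⟨u, hu, hFu⟩ := hω.2 _ (hF.image e)
        exact ⟨_, mem_image_of_mem _ hu, image_subset_iff.1 hFu⟩)
  let v : ℕ → V := hV2.natEmbedding
  have hv : ∀ n, ∃ u ∈ U, e ⁻¹' u = v n := fun n => hV (v n).2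
  choose u huU hu using hv
  refine ⟨u, huU, fun x => ?_⟩
  have := hV3 (e.symm x)
  rw [← Nat.cofinite_eq_atTop]
  refine eventually_cofinite.2 (Set.Finite.subset (Set.Finite.preimage
    (f := fun n => (v n : Set S)) (Function.Injective.injOn
      (Subtype.val_injective.comp hV2.natEmbedding.injective)) this) fun n hn => ?_)
  refine ⟨(v n).2, fun h => hn ?_⟩
  have h' : e.symm x ∈ e ⁻¹' u n := (hu n).symm ▸ h
  simpa using h'

/-- There are only countably many finite unions of basic open sets; one cover member above each
suffices. -/
theorem exists_countable_omegaCover {S : Type*} [TopologicalSpace S] [SecondCountableTopology S]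
    {U : Set (Set S)} (hU : ∀ u ∈ U, IsOpen u) (hω : IsOmegaCover U) :
    ∃ u : ℕ → Set S, (∀ n, u n ∈ U) ∧ ∀ F : Set S, F.Finite → ∃ n, F ⊆ u n := by
  let B := TopologicalSpace.countableBasis S
  let C : Set (Set (Set S)) := {c | (c.Finite ∧ c ⊆ B) ∧ ∃ u ∈ U, ⋃₀ c ⊆ u}
  have hC : C.Countable :=
    (countable_ofPred_finite_subset (TopologicalSpace.countable_countableBasis S)).mono
      fun c hc => hc.1
  have hCne : C.Nonempty := by
    obtain ⟨u, hu, -⟩ := hω.2 ∅ finite_empty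
    exact ⟨∅, ⟨finite_empty, empty_subset _⟩, u, hu, by simp⟩
  obtain ⟨c, hc⟩ := hC.exists_eq_range hCne
  have hcC : ∀ n, c n ∈ C := fun n => hc ▸ mem_range_self n
  choose u huU hu using fun n => (hcC n).2
  refine ⟨u, huU, fun F hF => ?_⟩
  obtain ⟨v, hv, hFv⟩ := hω.2 F hF
  have hb : ∀ x ∈ F, ∃ b ∈ B, x ∈ b ∧ b ⊆ v := fun x hx =>
    (TopologicalSpace.isBasis_countableBasis S).exists_subset_of_mem_open (hFv hx) (hU v hv)
  choose! b hbB hxb hbv using hb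
  have hmem : b '' F ∈ C := ⟨⟨hF.image b, image_subset_iff.2 hbB⟩, v, hv,
    sUnion_subset (forall_mem_image.2 hbv)⟩
  obtain ⟨n, hn⟩ := hc ▸ hmem
  exact ⟨n, fun x hx => hu n (hn ▸ ⟨b x, mem_image_of_mem b hx, hxb x hx⟩)⟩

/-- Sets of cardinality less than `𝔭` have the property `γ`, relative to the ambient space. -/
theorem exists_seq_of_card_lt {S : Type} [TopologicalSpace S] [SecondCountableTopology S]
    {U : Set (Set S)} (hU : ∀ u ∈ U, IsOpen u) (hω : IsOmegaCover U) {B : Set S}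
    (hB : #B < cardP) :
    ∃ u : ℕ → Set S, (∀ n, u n ∈ U) ∧ ∀ x ∈ B, ∀ᶠ n in atTop, x ∈ u n := by
  obtain ⟨u, huU, hu⟩ := exists_countable_omegaCover hU hω
  have hinf : ∀ F : Set S, F.Finite → {n | F ⊆ u n}.Infinite := by
    intro F hF
    -- Adding points missed by the first members forces a large index.
    have hp : ∀ n, ∃ p, p ∉ u n := fun n => (ne_univ_iff_exists_notMem _).1 (hω.1.1 _ (huU n))
    choose p hp using hp
    refine infinite_of_forall_exists_gt fun N => ?_
    obtain ⟨n, hn⟩ := hu (F ∪ p '' Iic N) (hF.union ((finite_Iic N).image p))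
    refine ⟨n, (subset_union_left.trans hn :), ?_⟩
    by_contra hlt
    exact hp n (hn (Or.inr (mem_image_of_mem p (not_lt.1 hlt))))
  obtain ⟨a, ha, ha'⟩ := exists_pseudointersection_of_lt (F := (fun x => {n | x ∈ u n}) '' B)
    (Cardinal.mk_image_le.trans_lt hB)
    (by
      rintro _ ⟨x, -, rfl⟩
      simpa using hinf {x} (finite_singleton x))
    (by
      intro s hs hfin
      obtain ⟨t, ht, htf, rfl⟩ := exists_subset_image_finite_and.1 ⟨s, hs, hfin, rfl⟩
      refine (hinf t htf).mono fun n hn => ?_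
      rintro _ ⟨x, hx, rfl⟩
      exact hn hx)
  refine ⟨fun n => u (Nat.nth (· ∈ a) n), fun n => huU _, fun x hx => ?_⟩
  have h1 : ∀ᶠ n in atTop, n ∉ a \ {n | x ∈ u n} := by
    rw [← Nat.cofinite_eq_atTop]
    exact (ha' _ (mem_image_of_mem _ hx)).eventually_cofinite_notMem
  filter_upwards [(Nat.nth_strictMono ha).tendsto_atTop.eventually h1] with n hn
  by_contra hx
  exact hn ⟨Nat.nth_mem_of_infinite ha n, hx⟩

/-! ### Property `γ` from an unbounded tower -/

section Tower

variable {S : Type} {e : S → ℕ → Bool}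

theorem finite_setOf_support_lt (hinj : Function.Injective e) (k : ℕ) :
    {s | ∀ i, e s i = true → i < k}.Finite := by
  refine Set.Finite.of_finite_image (f := fun s (i : Fin k) => e s i) (toFinite _) ?_
  intro s hs t ht hst
  refine hinj (funext fun i => ?_)
  by_cases hi : i < k
  · exact congrFun hst ⟨i, hi⟩
  · rw [Bool.eq_false_iff.2 fun h => hi (hs i h), Bool.eq_false_iff.2 fun h => hi (ht i h)]

variable [TopologicalSpace S]

theorem exists_forall_eq_imp_mem (he : IsInducing e) {u : Set S} (hu : IsOpen u) {s : S}
    (hs : s ∈ u) : ∃ h, ∀ t, (∀ i < h, e t i = e s i) → t ∈ u := by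
  obtain ⟨O, hO, rfl⟩ := he.isOpen_iff.1 hu
  obtain ⟨I, v, hv, hsub⟩ := isOpen_pi_iff.1 hO (e s) hs
  refine ⟨I.sup id + 1, fun t ht => hsub fun i hi => ?_⟩
  rw [ht i (Nat.lt_succ_of_le (Finset.le_sup (f := id) hi))]
  exact (hv i hi).2

/-- Only finitely many points are supported below `k`, so one `h` serves all their neighbourhoods. A
point vanishing on `[k, h)` agrees below `h` with its truncation at `k`. -/
theorem exists_disjoint_imp_mem (he : IsInducing e) (hinj : Function.Injective e)
    (htrunc : ∀ s k, ∃ s', ∀ i, e s' i = if i < k then e s i else false)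
    {u : Set S} (hu : IsOpen u) {k : ℕ} (hk : {s | ∀ i, e s i = true → i < k} ⊆ u) :
    ∃ h, ∀ s, (∀ i ∈ Ico k h, e s i = false) → s ∈ u := by
  have h := fun s hs => exists_forall_eq_imp_mem he hu (hk hs : s ∈ u)
  choose! h hh using h
  obtain ⟨H, hH⟩ := ((finite_setOf_support_lt hinj k).image h).bddAbove
  refine ⟨H, fun s hs => ?_⟩
  obtain ⟨s', hs'⟩ := htrunc s k
  have hmem : s' ∈ {s | ∀ i, e s i = true → i < k} := by
    intro i hi
    by_contra hik
    simp [hs', hik] at hi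
  refine hh s' hmem s fun i hi => ?_
  rw [hs']
  split_ifs with hik
  · rfl
  · exact hs i ⟨not_lt.1 hik, hi.trans_le (hH (mem_image_of_mem h hmem))⟩

/-- The countably many finitely supported points can be added to `B`; thinning the sequence then
puts all points supported below `k` into the `k`-th set. -/
theorem exists_seq_disjoint_imp_mem (hpb : cardP = cardB) (he : IsInducing e)
    (hinj : Function.Injective e)
    (htrunc : ∀ s k, ∃ s', ∀ i, e s' i = if i < k then e s i else false)
    {U : Set (Set S)} (hU : ∀ u ∈ U, IsOpen u) (hω : IsOmegaCover U) {B : Set S}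
    (hB : #B < cardB) :
    ∃ (v : ℕ → Set S) (h : ℕ → ℕ), (∀ k, v k ∈ U) ∧ (∀ s ∈ B, ∀ᶠ k in atTop, s ∈ v k) ∧
      ∀ k s, (∀ i ∈ Ico k (h k), e s i = false) → s ∈ v k := by
  have : SecondCountableTopology S := he.secondCountableTopology
  have hcount : (⋃ k, {s | ∀ i, e s i = true → i < k}).Countable :=
    countable_iUnion fun k => (finite_setOf_support_lt hinj k).countable
  obtain ⟨u, huU, hu⟩ := exists_seq_of_card_lt hU hω
    (B := B ∪ ⋃ k, {s | ∀ i, e s i = true → i < k}) (by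
      rw [hpb]
      exact (Cardinal.mk_union_le _ _).trans_lt (Cardinal.add_lt_of_lt aleph0_lt_cardB.le hB
        ((Cardinal.le_aleph0_iff_set_countable.2 hcount).trans_lt aleph0_lt_cardB)))
  have hex : ∀ k, ∃ j ≥ k, {s | ∀ i, e s i = true → i < k} ⊆ u j := fun k => by
    have := (eventually_all_finite (finite_setOf_support_lt hinj k)).2
      fun s hs => hu s (Or.inr (mem_iUnion.2 ⟨k, hs⟩))
    obtain ⟨j, hj, hjk⟩ := (this.and (eventually_ge_atTop k)).exists
    exact ⟨j, hjk, hj⟩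
  choose j hjk hj using hex
  choose h hh using fun k => exists_disjoint_imp_mem he hinj htrunc (hU _ (huU (j k))) (hj k)
  exact ⟨fun k => u (j k), h, fun k => huU _, fun s hs =>
    (tendsto_atTop_mono hjk tendsto_id).eventually (hu s (Or.inl hs)), hh⟩

/-- A space coded by finite sets and by subsets of the members of an unbounded tower of length
`𝔟 = 𝔭` has the property `γ`. -/
theorem hasPropertyGamma_of_tower (hpb : cardP = cardB) (he : IsInducing e)
    (hinj : Function.Injective e)
    (htrunc : ∀ s k, ∃ s', ∀ i, e s' i = if i < k then e s i else false)
    {ι : Type} [LinearOrder ι] [WellFoundedLT ι] [Nonempty ι] (T : ι → Set ℕ)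
    (htower : ∀ α β, α ≤ β → (T β \ T α).Finite)
    (hgap : ∀ h : ℕ → ℕ, ∃ α, ∃ᶠ k in atTop, Disjoint (T α) (Ico k (h k)))
    (hub : ∀ a : ℕ → ι, ∃ α, ∀ n, a n ≤ α) (W : ι → Set S)
    (hcov : ∀ s, {i | e s i = true}.Finite ∨ ∃ α, s ∈ W α)
    (hW : ∀ α, ∀ s ∈ W α, ∀ i, e s i = true → i ∈ T α)
    (hcard : ∀ α, #(⋃ β ∈ Iio α, W β : Set S) < cardB) : HasPropertyGamma S := by
  refine hasPropertyGamma_of_exists_seq fun U hU hω => ?_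
  have hfin : ∀ A : Set ℕ, A.Finite → ∃ c, ∀ i ∈ A, i < c := fun A hA => by
    obtain ⟨c, hc⟩ := hA.bddAbove
    exact ⟨c + 1, fun i hi => Nat.lt_succ_of_le (hc hi)⟩
  have hstep : ∀ α, ∃ α' ≥ α, ∃ (v : ℕ → Set S) (k h : ℕ → ℕ), StrictMono k ∧ (∀ j, v j ∈ U) ∧
      (∀ β < α, ∀ s ∈ W β, ∀ᶠ j in atTop, s ∈ v j) ∧
      (∀ j, Disjoint (T α') (Ico (k j) (h j))) ∧
      ∀ j s, (∀ i ∈ Ico (k j) (h j), e s i = false) → s ∈ v j := by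
    intro α
    obtain ⟨v, h, hvU, hv, hd⟩ := exists_seq_disjoint_imp_mem hpb he hinj htrunc hU hω (hcard α)
    obtain ⟨α', hα', hfreq⟩ : ∃ α' ≥ α, ∃ᶠ k in atTop, Disjoint (T α') (Ico k (h k)) := by
      obtain ⟨γ, hγ⟩ := hgap h
      rcases le_total α γ with hle | hle
      · exact ⟨γ, hle, hγ⟩
      -- Here `T α` is almost contained in `T γ`, so it misses the same intervals from some point
      -- on.
      · obtain ⟨c, hc⟩ := hfin _ (htower γ α hle)
        refine ⟨α, le_rfl, (hγ.and_eventually (eventually_ge_atTop c)).mono ?_⟩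
        rintro k ⟨hk, hck⟩
        rw [disjoint_left] at hk ⊢
        intro i hi hik
        by_contra
        refine absurd (hc i ⟨hi, fun hiγ => hk hiγ hik⟩) (not_lt.2 (hck.trans hik.1))
    obtain ⟨k, hk, hkd⟩ := extraction_of_frequently_atTop hfreq
    exact ⟨α', hα', fun j => v (k j), k, fun j => h (k j), hk, fun j => hvU _,
      fun β hβ s hs => hk.tendsto_atTop.eventually (hv s (mem_biUnion hβ hs)), hkd,
      fun j s hs => hd _ s hs⟩
  choose N hN v k h hk hvU hv hd hvd using hstep
  let a : ℕ → ι := fun n => N^[n] (Classical.arbitrary ι)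
  have ha : ∀ n, a (n + 1) = N (a n) := fun n => Function.iterate_succ_apply' _ _ _
  have hamono : Monotone a := monotone_nat_of_le_succ fun n => by
    rw [ha]
    exact hN _
  -- The least upper bound, so that every `β < α` is already handled at almost all stages `n`.
  obtain ⟨α, hα, hmin⟩ : ∃ α, (∀ n, a n ≤ α) ∧ ∀ β < α, ∃ n, β < a n := by
    have hwf := (wellFounded_lt (α := ι)).has_min {α | ∀ n, a n ≤ α} (hub a)
    obtain ⟨α, hα, hmin⟩ := hwf
    refine ⟨α, hα, fun β hβ => ?_⟩
    by_contra! hcon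
    exact hmin β hcon hβ
  choose c hc using fun n => hfin _ (htower _ _ (hα (n + 1)))
  have hex : ∀ s : (⋃ β ∈ Iio α, W β : Set S), ∃ f : ℕ → ℕ,
      ∀ᶠ n in atTop, ∀ j ≥ f n, (s : S) ∈ v (a n) j := by
    rintro ⟨s, hs⟩
    simp only [mem_iUnion] at hs
    obtain ⟨β, hβ, hs⟩ := hs
    obtain ⟨m, hm⟩ := hmin β hβ
    have : ∀ n, m ≤ n → ∃ c, ∀ j ≥ c, s ∈ v (a n) j := fun n hn =>
      eventually_atTop.1 (hv (a n) β (hm.trans_le (hamono hn)) s hs)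
    choose! f hf using this
    exact ⟨f, eventually_atTop.2 ⟨m, hf⟩⟩
  choose f hf using hex
  obtain ⟨g, hg⟩ := exists_bound_of_lt_cardB (hcard α) f
  -- The index puts the chosen interval beyond `n` and beyond the finite set `T α \ T (a (n + 1))`;
  -- the bound `g n` serves the points with index below `α`.
  have hlate : ∀ s l, (∀ i, e s i = true → i ∈ T α ∨ i < l) →
      ∀ᶠ n in atTop, s ∈ v (a n) (max n (max (c n) (g n))) := by
    intro s l hs
    filter_upwards [eventually_ge_atTop l] with n hn
    refine hvd _ _ _ fun i hi => Bool.eq_false_iff.2 fun hei => ?_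
    have hki : max n (max (c n) (g n)) ≤ i := (hk (a n)).le_apply.trans hi.1
    rcases hs i hei with hT | hl
    · have hnot : i ∉ T (a (n + 1)) := fun hi' => disjoint_left.1 (hd (a n) _) (ha n ▸ hi') hi
      have := hc n i ⟨hT, hnot⟩
      omega
    · omega
  refine ⟨fun n => v (a n) (max n (max (c n) (g n))), fun n => hvU _ _, fun s => ?_⟩
  rcases hcov s with hs | ⟨β, hβ⟩
  · obtain ⟨l, hl⟩ := hfin _ hs
    exact hlate s l fun i hi => Or.inr (hl i hi)
  · rcases lt_or_ge β α with hlt | hge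
    · have hs : s ∈ (⋃ β ∈ Iio α, W β : Set S) := mem_biUnion hlt hβ
      filter_upwards [hg ⟨s, hs⟩, hf ⟨s, hs⟩] with n h1 h2
      exact h2 _ (h1.trans (by omega))
    · obtain ⟨l, hl⟩ := hfin _ (htower α β hge)
      refine hlate s l fun i hi => ?_
      by_cases hT : i ∈ T α
      · exact Or.inl hT
      · exact Or.inr (hl i ⟨hW β s hβ i hi, hT⟩)

end Tower

/-! ### Binary expansions and the coin measure -/

/-- The real number with a given sequence of binary digits. -/
noncomputable def binaryReal (w : ℕ → Bool) : ℝ :=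
  Real.ofDigits (b := 2) fun i => if w i then 1 else 0

/-- The sequence of binary digits of a real number in `[0, 1)`. -/
noncomputable def binaryDigits (r : ℝ) : ℕ → Bool := fun i => decide (Real.digits r 2 i = 1)

theorem ofDigitsTerm_two (w : ℕ → Bool) (i : ℕ) :
    Real.ofDigitsTerm (b := 2) (fun i => if w i then 1 else 0) i =
      if w i then ((2 : ℝ) ^ (i + 1))⁻¹ else 0 := by
  unfold Real.ofDigitsTerm
  cases h : w i <;> simp [h]

theorem binaryReal_eq_tsum (w : ℕ → Bool) :
    binaryReal w = ∑' i, if w i then ((2 : ℝ) ^ (i + 1))⁻¹ else 0 :=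
  tsum_congr fun i => ofDigitsTerm_two w i

theorem summable_binaryReal (w : ℕ → Bool) :
    Summable fun i => if w i then ((2 : ℝ) ^ (i + 1))⁻¹ else 0 := by
  exact (Real.summable_ofDigitsTerm (b := 2) (digits := fun i => if w i then 1 else 0)).congr
    (ofDigitsTerm_two w)

theorem continuous_binaryReal : Continuous binaryReal :=
  Real.continuous_ofDigits.comp (continuous_pi fun i =>
    (continuous_of_discreteTopology (f := fun b : Bool => if b then (1 : Fin 2) else 0)).comp
      (continuous_apply i))

theorem binaryReal_eq_sum_add (w : ℕ → Bool) (n : ℕ) :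
    binaryReal w = (∑ i ∈ Finset.range n, if w i then ((2 : ℝ) ^ (i + 1))⁻¹ else 0) +
      ((2 : ℝ) ^ n)⁻¹ * binaryReal fun i => w (i + n) := by
  rw [binaryReal, Real.ofDigits_eq_sum_add_ofDigits _ n]
  simp only [ofDigitsTerm_two]
  rfl

theorem binaryReal_nonneg (w : ℕ → Bool) : 0 ≤ binaryReal w := Real.ofDigits_nonneg _

theorem binaryReal_lt_one {w : ℕ → Bool} {k : ℕ} (hk : w k = false) : binaryReal w < 1 := by
  have h1 : binaryReal (fun _ => true) ≤ 1 := Real.ofDigits_le_one _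
  refine lt_of_lt_of_le ?_ h1
  rw [binaryReal_eq_tsum, binaryReal_eq_tsum]
  refine Summable.tsum_lt_tsum (i := k) (fun i => ?_) ?_ (summable_binaryReal w)
    (summable_binaryReal _)
  · cases w i <;> simp
  · simp [hk]

theorem binaryReal_binaryDigits {r : ℝ} (hr : r ∈ Ico (0 : ℝ) 1) :
    binaryReal (binaryDigits r) = r := by
  conv_rhs => rw [← Real.ofDigits_digits one_lt_two hr]
  rw [binaryReal]
  congr 1
  funext i
  have : ∀ d : Fin 2, (if decide (d = 1) = true then (1 : Fin 2) else 0) = d := by decide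
  exact this _

theorem exists_nat_sum_binary (w : ℕ → Bool) (n : ℕ) :
    ∃ m : ℕ, (2 : ℝ) ^ n * (∑ i ∈ Finset.range n, if w i then ((2 : ℝ) ^ (i + 1))⁻¹ else 0) = m := by
  induction n with
  | zero => exact ⟨0, by simp⟩
  | succ n ih =>
    obtain ⟨m, hm⟩ := ih
    refine ⟨2 * m + if w n then 1 else 0, ?_⟩
    rw [Finset.sum_range_succ, mul_add, pow_succ', mul_assoc, hm]
    split_ifs
    · push_cast
      rw [← pow_succ', mul_inv_cancel₀ (by positivity)]
    · simp

/-- A later zero makes the tail after `n + 1` digits less than 1, so the floor reads off the digits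
exactly. -/
theorem binaryDigits_binaryReal {w : ℕ → Bool} (hw : ∃ᶠ i in atTop, w i = false) :
    binaryDigits (binaryReal w) = w := by
  funext n
  obtain ⟨m, hm⟩ := exists_nat_sum_binary w n
  have hfloor : ⌊binaryReal w * (2 : ℕ) ^ (n + 1)⌋₊ = 2 * m + if w n then 1 else 0 := by
    obtain ⟨j, hj, hwj⟩ := frequently_atTop.1 hw (n + 1)
    have h1 : binaryReal (fun i => w (i + (n + 1))) < 1 :=
      binaryReal_lt_one (k := j - (n + 1)) (by rw [Nat.sub_add_cancel hj]; exact hwj)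
    have h0 := binaryReal_nonneg (fun i => w (i + (n + 1)))
    have hval : binaryReal w * (2 : ℕ) ^ (n + 1) =
        ((2 * m + if w n then 1 else 0 : ℕ) : ℝ) + binaryReal (fun i => w (i + (n + 1))) := by
      rw [binaryReal_eq_sum_add w (n + 1), Finset.sum_range_succ]
      have h2 : (2 : ℝ) ^ (n + 1) ≠ 0 := by positivity
      push_cast
      rw [← hm]
      split_ifs
      · field_simp
        ring
      · field_simp
        ring
    rw [hval, Nat.floor_eq_iff (by positivity)]
    constructor <;> linarith
  have hd : Real.digits (binaryReal w) 2 n = if w n then 1 else 0 := by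
    rw [Real.digits, hfloor]
    apply Fin.ext
    split_ifs <;> simp [Fin.ofNat, Nat.add_mod]
  rw [binaryDigits, hd]
  cases w n <;> simp

/-- Disjoint supports produce no carries. -/
theorem binaryReal_add {w x y : ℕ → Bool} (h : ∀ i, w i = (x i || y i))
    (hd : ∀ i, ¬ (x i = true ∧ y i = true)) : binaryReal w = binaryReal x + binaryReal y := by
  simp only [binaryReal_eq_tsum]
  rw [← Summable.tsum_add (summable_binaryReal x) (summable_binaryReal y)]
  refine tsum_congr fun i => ?_
  have h1 := h i
  have h2 := hd i
  cases hx : x i <;> cases hy : y i <;> simp_all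

theorem measurable_binaryDigits : Measurable binaryDigits := by
  refine measurable_pi_lambda _ fun i => ?_
  have h1 : Measurable fun d : ℕ => decide (Fin.ofNat 2 d = 1) := measurable_of_countable _
  exact h1.comp (Nat.measurable_floor.comp (measurable_id.mul_const _))

theorem fairCoin_singleton (b : Bool) : (PMF.uniformOfFintype Bool).toMeasure {b} = 2⁻¹ := by
  rw [PMF.toMeasure_apply_singleton _ _ (measurableSet_singleton b)]
  simp

instance : IsProbabilityMeasure cantorMeasure := by
  unfold cantorMeasure
  infer_instance

theorem cantorMeasure_pi (s : Finset ℕ) (c : ℕ → Bool) :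
    cantorMeasure {w | ∀ i ∈ s, w i = c i} = 2⁻¹ ^ s.card := by
  have : {w : ℕ → Bool | ∀ i ∈ s, w i = c i} = Set.pi s fun i => {c i} := by
    ext w
    simp
  rw [this, cantorMeasure, Measure.infinitePi_pi _ fun _ _ => measurableSet_singleton _]
  simp only [fairCoin_singleton, Finset.prod_const]

theorem volume_binaryDigits_le (n : ℕ) (c : ℕ → Bool) :
    (volume.restrict (Ico (0 : ℝ) 1)).map binaryDigits {w | ∀ i ∈ Finset.range n, w i = c i} ≤
      2⁻¹ ^ n := by
  have hmeas : MeasurableSet {w : ℕ → Bool | ∀ i ∈ Finset.range n, w i = c i} := by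
    have : {w : ℕ → Bool | ∀ i ∈ Finset.range n, w i = c i} =
        Set.pi (Finset.range n) fun i => {c i} := by
      ext w
      simp
    rw [this]
    exact MeasurableSet.pi (Finset.countable_toSet _) fun _ _ => measurableSet_singleton _
  rw [Measure.map_apply measurable_binaryDigits hmeas,
    Measure.restrict_apply (measurable_binaryDigits hmeas)]
  let q := ∑ i ∈ Finset.range n, if c i then ((2 : ℝ) ^ (i + 1))⁻¹ else 0
  calc _ ≤ volume (Icc q (q + (2⁻¹ : ℝ) ^ n)) := measure_mono ?_
    _ = _ := by
      rw [Real.volume_Icc, add_sub_cancel_left, ENNReal.ofReal_pow (by norm_num),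
        ENNReal.ofReal_inv_of_pos two_pos, ENNReal.ofReal_ofNat]
  rintro r ⟨hr, hr1⟩
  have hq : q = ∑ i ∈ Finset.range n,
      if binaryDigits r i then ((2 : ℝ) ^ (i + 1))⁻¹ else 0 := by
    refine Finset.sum_congr rfl fun i hi => ?_
    rw [hr i hi]
  have h1 := binaryReal_eq_sum_add (binaryDigits r) n
  rw [binaryReal_binaryDigits hr1, ← hq] at h1
  have h2 := binaryReal_nonneg fun i => binaryDigits r (i + n)
  have h3 : binaryReal (fun i => binaryDigits r (i + n)) ≤ 1 := Real.ofDigits_le_one _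
  have h4 : (0 : ℝ) < ((2 : ℝ) ^ n)⁻¹ := by positivity
  rw [mem_Icc, inv_pow]
  constructor <;> nlinarith

/-- An upper bound on cylinders suffices: on the finite space of the first `n` digits, two
probability measures comparable on atoms are equal. -/
theorem map_binaryDigits_volume :
    (volume.restrict (Ico (0 : ℝ) 1)).map binaryDigits = cantorMeasure := by
  have : IsProbabilityMeasure (volume.restrict (Ico (0 : ℝ) 1)) := ⟨by simp⟩
  have : IsProbabilityMeasure ((volume.restrict (Ico (0 : ℝ) 1)).map binaryDigits) :=
    Measure.isProbabilityMeasure_map measurable_binaryDigits.aemeasurable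
  generalize hν : (volume.restrict (Ico (0 : ℝ) 1)).map binaryDigits = ν at *
  have hle : ∀ (n : ℕ) (c : ℕ → Bool), ν {w | ∀ i ∈ Finset.range n, w i = c i} ≤ 2⁻¹ ^ n := fun n c =>
    hν ▸ volume_binaryDigits_le n c
  let ρ (n : ℕ) (w : ℕ → Bool) (i : Fin n) : Bool := w i
  have hρ : ∀ n, Measurable (ρ n) := fun n => by fun_prop
  have hpre : ∀ n (d : Fin n → Bool), ∃ c : ℕ → Bool,
      ρ n ⁻¹' {d} = {w | ∀ i ∈ Finset.range n, w i = c i} := by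
    intro n d
    refine ⟨fun i => if h : i < n then d ⟨i, h⟩ else false, ?_⟩
    ext w
    simp only [mem_preimage, mem_singleton_iff, Finset.mem_range, mem_ofPred_eq, funext_iff, ρ]
    constructor
    · intro h i hi
      rw [dif_pos hi, ← h ⟨i, hi⟩]
    · intro h i
      rw [h i i.2, dif_pos i.2]
  have hmap : ∀ n, ν.map (ρ n) = cantorMeasure.map (ρ n) := by
    intro n
    have hP1 : IsProbabilityMeasure (ν.map (ρ n)) :=
      Measure.isProbabilityMeasure_map (hρ n).aemeasurable
    have hP2 : IsProbabilityMeasure (cantorMeasure.map (ρ n)) :=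
      Measure.isProbabilityMeasure_map (hρ n).aemeasurable
    have hles : ∀ d : Fin n → Bool, ν.map (ρ n) {d} ≤ cantorMeasure.map (ρ n) {d} := by
      intro d
      obtain ⟨c, hc⟩ := hpre n d
      rw [Measure.map_apply (hρ n) (measurableSet_singleton d),
        Measure.map_apply (hρ n) (measurableSet_singleton d), hc, cantorMeasure_pi,
        Finset.card_range]
      exact hle n c
    refine Measure.eq_of_le_of_measure_univ_eq ?_ (by simp)
    refine Measure.le_iff.2 fun A _ => ?_
    have hsum := fun μ : Measure (Fin n → Bool) => sum_measure_singleton (μ := μ)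
      (s := (toFinite A).toFinset)
    simp only [Finite.coe_toFinset] at hsum
    rw [← hsum, ← hsum]
    exact Finset.sum_le_sum fun d _ => hles d
  rw [cantorMeasure]
  refine Measure.eq_infinitePi _ fun s t ht => ?_
  obtain ⟨n, hn⟩ : ∃ n, ∀ i ∈ s, i < n :=
    ⟨s.sup id + 1, fun i hi => Nat.lt_succ_of_le (Finset.le_sup (f := id) hi)⟩
  have hst : Set.pi s t = ρ n ⁻¹' {d | ∀ i (hi : i ∈ s), d ⟨i, hn i hi⟩ ∈ t i} := by
    ext w
    simp [ρ, Set.mem_pi]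
  rw [← Measure.infinitePi_pi _ fun i _ => ht i, ← cantorMeasure, hst,
    ← Measure.map_apply (hρ n) (toFinite _).measurableSet,
    ← Measure.map_apply (hρ n) (toFinite _).measurableSet, hmap]

/-! ### Digit blocks between squares -/

/-- The interval strictly between the `n`-th and the next positive square. -/
def squareGap (n : ℕ) : Finset ℕ := Finset.Ioo ((n + 1) ^ 2) ((n + 2) ^ 2)

theorem card_squareGap (n : ℕ) : (squareGap n).card = 2 * n + 2 := by
  rw [squareGap, Nat.card_Ioo]
  have : (n + 2) ^ 2 = (n + 1) ^ 2 + (2 * n + 3) := by ring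
  omega

theorem sq_notMem_squareGap (m n : ℕ) : m ^ 2 ∉ squareGap n := by
  rw [squareGap, Finset.mem_Ioo]
  rintro ⟨h1, h2⟩
  have := lt_of_pow_lt_pow_left₀ 2 (Nat.zero_le _) h1
  have := lt_of_pow_lt_pow_left₀ 2 (Nat.zero_le _) h2
  omega

theorem eq_of_mem_squareGap {i m n : ℕ} (hm : i ∈ squareGap m) (hn : i ∈ squareGap n) :
    m = n := by
  rw [squareGap, Finset.mem_Ioo] at hm hn
  have := lt_of_pow_lt_pow_left₀ 2 (Nat.zero_le _) (hm.1.trans hn.2)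
  have := lt_of_pow_lt_pow_left₀ 2 (Nat.zero_le _) (hn.1.trans hm.2)
  omega

/-- The union of the square gaps with indices in `a`. -/
def gapUnion (a : Set ℕ) : Set ℕ := ⋃ n ∈ a, (squareGap n : Set ℕ)

theorem mem_gapUnion {a : Set ℕ} {i : ℕ} : i ∈ gapUnion a ↔ ∃ n ∈ a, i ∈ squareGap n := by
  simp [gapUnion]

theorem sq_notMem_gapUnion (a : Set ℕ) (m : ℕ) : m ^ 2 ∉ gapUnion a := by
  rw [mem_gapUnion]
  rintro ⟨n, -, h⟩
  exact sq_notMem_squareGap m n h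

theorem gapUnion_injective : Function.Injective gapUnion := by
  have h : ∀ a b, gapUnion a = gapUnion b → a ⊆ b := by
    intro a b hab n hn
    obtain ⟨i, hi⟩ : (squareGap n).Nonempty := by
      rw [← Finset.card_pos, card_squareGap]
      omega
    obtain ⟨m, hm, him⟩ := mem_gapUnion.1 (hab ▸ mem_gapUnion.2 ⟨n, hn, hi⟩)
    exact eq_of_mem_squareGap hi him ▸ hm
  exact fun a b hab => (h a b hab).antisymm (h b a hab.symm)

theorem finite_gapUnion_diff {a b : Set ℕ} (h : (a \ b).Finite) :
    (gapUnion a \ gapUnion b).Finite := by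
  refine (h.biUnion fun n _ => (squareGap n).finite_toSet).subset ?_
  rintro i ⟨hi, hib⟩
  obtain ⟨n, hn, hin⟩ := mem_gapUnion.1 hi
  exact mem_biUnion ⟨hn, fun hnb => hib (mem_gapUnion.2 ⟨n, hnb, hin⟩)⟩ hin

/-- A block meeting `[(k + 1) ^ 2, l)` has its index in `[k, l)`. -/
theorem disjoint_gapUnion {a : Set ℕ} {k l : ℕ} (h : Disjoint a (Ico k l)) :
    Disjoint (gapUnion a) (Ico ((k + 1) ^ 2) l) := by
  rw [disjoint_left] at h ⊢
  intro i hi hik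
  obtain ⟨n, hn, hin⟩ := mem_gapUnion.1 hi
  rw [squareGap, Finset.mem_Ioo] at hin
  have h1 := lt_of_pow_lt_pow_left₀ 2 (Nat.zero_le _) (hik.1.trans_lt hin.2)
  refine h hn ⟨by omega, lt_of_le_of_lt ?_ (hin.1.trans hik.2)⟩
  nlinarith

/-- Sequences that vanish on infinitely many square gaps. -/
def vanishingSequences : Set (ℕ → Bool) :=
  {w | ∃ᶠ n in atTop, ∀ i ∈ squareGap n, w i = false}

theorem cantorMeasure_vanishingSequences : cantorMeasure vanishingSequences = 0 := by
  refine measure_setOfPred_frequently_eq_zero ?_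
  have h : ∀ n, cantorMeasure {w | ∀ i ∈ squareGap n, w i = false} ≤ 2⁻¹ ^ n := by
    intro n
    rw [cantorMeasure_pi _ fun _ => false, card_squareGap]
    exact pow_le_pow_right_of_le_one' (by simp) (by omega)
  refine ne_top_of_le_ne_top ?_ (ENNReal.tsum_le_tsum h)
  rw [ENNReal.tsum_geometric]
  simp

theorem volume_image_vanishingSequences : volume (binaryReal '' vanishingSequences) = 0 := by
  have hsub : binaryReal '' vanishingSequences ⊆
      binaryDigits ⁻¹' vanishingSequences ∩ Ico (0 : ℝ) 1 := by
    rintro _ ⟨w, hw, rfl⟩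
    have hfr : ∃ᶠ i in atTop, w i = false := by
      rw [frequently_atTop]
      intro N
      obtain ⟨n, hn, h⟩ := frequently_atTop.1 hw N
      refine ⟨(n + 1) ^ 2 + 1, by nlinarith, h _ ?_⟩
      rw [squareGap, Finset.mem_Ioo]
      constructor <;> nlinarith
    obtain ⟨k, hk⟩ := hfr.exists
    refine ⟨?_, binaryReal_nonneg w, binaryReal_lt_one hk⟩
    rw [mem_preimage, binaryDigits_binaryReal hfr]
    exact hw
  refine measure_mono_null hsub (le_antisymm ?_ zero_le)
  calc _ ≤ volume.restrict (Ico (0 : ℝ) 1) (binaryDigits ⁻¹' vanishingSequences) :=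
        Measure.le_restrict_apply _ _
    _ ≤ (volume.restrict (Ico (0 : ℝ) 1)).map binaryDigits vanishingSequences :=
        Measure.le_map_apply measurable_binaryDigits.aemeasurable _
    _ = 0 := by rw [map_binaryDigits_volume, cantorMeasure_vanishingSequences]

theorem cantorMeasure_eq_zero_of_volume_image {Z : Set (ℕ → Bool)}
    (h : volume (binaryReal '' Z) = 0) : cantorMeasure Z = 0 := by
  obtain ⟨s, hs, hsm, hs0⟩ := exists_measurable_superset_of_null h
  refine measure_mono_null (image_subset_iff.1 hs) ?_
  rw [← map_binaryDigits_volume, Measure.map_apply measurable_binaryDigits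
    (continuous_binaryReal.measurable hsm), Measure.restrict_apply
    (measurable_binaryDigits (continuous_binaryReal.measurable hsm))]
  refine measure_mono_null ?_ hs0
  rintro r ⟨hr, hr1⟩
  simpa only [mem_preimage, binaryReal_binaryDigits hr1] using hr

/-- Sequences that vanish at all squares. -/
def guardedSequences : Set (ℕ → Bool) := {w | ∀ m, w (m ^ 2) = false}

theorem isClosed_guardedSequences : IsClosed guardedSequences := by
  simp only [guardedSequences, ofPred_forall]
  exact isClosed_iInter fun m => isClosed_eq (continuous_apply _) continuous_const

/-- Zeros at the squares exclude double expansions, so the map is injective, and its domain is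
compact. -/
theorem isEmbedding_binaryReal_guardedSequences :
    IsEmbedding fun w : guardedSequences => binaryReal w := by
  have : CompactSpace guardedSequences :=
    isCompact_iff_compactSpace.1 isClosed_guardedSequences.isCompact
  refine ((continuous_binaryReal.comp continuous_subtype_val).isClosedEmbedding ?_).isEmbedding
  have h : ∀ w : guardedSequences, binaryDigits (binaryReal w) = w := fun w =>
    binaryDigits_binaryReal (frequently_atTop.2 fun N => ⟨N ^ 2, by nlinarith, w.2 N⟩)
  intro w w' hww'
  refine Subtype.ext ?_
  rw [← h w, ← h w']
  exact congrArg binaryDigits hww'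

/-! ### The set `X` -/

theorem exists_nonnull_range (hnon : cardNonNull ≤ cardB) :
    ∃ z : cardB.ord.ToType → ℕ → Bool, cantorMeasure (range z) ≠ 0 := by
  obtain ⟨Z, hZ, hc⟩ := csInf_mem
    (s := {κ | ∃ Z : Set (ℕ → Bool), cantorMeasure Z ≠ 0 ∧ #Z = κ})
    ⟨_, univ, by simp, rfl⟩
  have hle : #Z ≤ #cardB.ord.ToType := by
    rw [hc, Cardinal.mk_ord_toType]
    exact hnon
  obtain ⟨g⟩ := hle
  have hne : Nonempty Z := by
    rw [nonempty_coe_sort, nonempty_iff_ne_empty]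
    rintro rfl
    simp at hZ
  refine ⟨fun α => (Function.invFun g α : Z), ?_⟩
  rwa [range_comp' Subtype.val, (Function.invFun_surjective g.injective).range_eq, image_univ,
    Subtype.range_coe]

theorem mainTheorem4 (hpb : cardP = cardB) (hnon : cardNonNull ≤ cardB) :
    ∃ X : Set ℝ, cardP ≤ #X ∧ HasPropertyGamma X ∧ ¬ IsNullAdditive X := by
  classical
  obtain ⟨f, hf, htower, hunb⟩ := exists_unbounded_tower hpb
  obtain ⟨z, hz⟩ := exists_nonnull_range hnon
  let T : cardB.ord.ToType → Set ℕ := fun α => gapUnion (range (f α))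
  let t : cardB.ord.ToType → ℕ → Bool := fun α i => decide (i ∈ T α)
  let y : cardB.ord.ToType → ℕ → Bool := fun α i => z α i && decide (i ∈ T α)
  -- Finite sequences provide the truncations. The `t α` secure the cardinality, since the `y α` may
  -- coincide.
  let Y : Set (ℕ → Bool) :=
    {w | w ∈ guardedSequences ∧ {i | w i = true}.Finite} ∪ (range t ∪ range y)
  have hY : Y ⊆ guardedSequences := by
    rintro w (hw | ⟨α, rfl⟩ | ⟨α, rfl⟩) m
    · exact hw.1 m
    · simpa [t] using sq_notMem_gapUnion _ m
    · simp only [y, T, sq_notMem_gapUnion, decide_false, Bool.and_false]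
  let Y' : Set guardedSequences := Subtype.val ⁻¹' Y
  have hYX : binaryReal '' Y = (fun w : guardedSequences => binaryReal w) '' Y' := by
    rw [← image_image binaryReal Subtype.val, Subtype.image_preimage_coe,
      inter_eq_right.2 hY]
  have hgamma : HasPropertyGamma Y' := by
    have : Nonempty cardB.ord.ToType := by
      rw [← Cardinal.mk_ne_zero_iff, Cardinal.mk_ord_toType]
      exact (Cardinal.aleph0_pos.trans aleph0_lt_cardB).ne'
    refine hasPropertyGamma_of_tower (e := fun s : Y' => ((s : guardedSequences) : ℕ → Bool)) hpb
      (IsInducing.subtypeVal.comp IsInducing.subtypeVal)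
      (Subtype.val_injective.comp Subtype.val_injective) ?_ T
      (fun α β h => finite_gapUnion_diff (htower α β h)) (fun h => ?_)
      (exists_upper_bound_of_unbounded f hunb)
      (fun α => {s | ((s : guardedSequences) : ℕ → Bool) ∈ ({t α, y α} : Set (ℕ → Bool))})
      ?_ ?_ fun α => ?_
    · intro s k
      have hmem : (fun i => if i < k then ((s : guardedSequences) : ℕ → Bool) i else false) ∈
          guardedSequences := by
        intro m
        simp only [s.1.2 m, ite_self]
      refine ⟨⟨⟨_, hmem⟩, Or.inl ⟨hmem, (finite_lt_nat k).subset fun i hi => ?_⟩⟩, fun i => rfl⟩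
      by_contra hik
      simp only [mem_ofPred_eq] at hi hik
      simp [hik] at hi
    · obtain ⟨g, hg⟩ := exists_forall_frequently_disjoint fun k => h ((k + 1) ^ 2)
      obtain ⟨α, hα⟩ := hunb g
      refine ⟨α, frequently_atTop.2 fun N => ?_⟩
      obtain ⟨k, hk, hd⟩ := frequently_atTop.1 (hg (f α) (hf α) hα) N
      exact ⟨(k + 1) ^ 2, by nlinarith, disjoint_gapUnion hd⟩
    · rintro ⟨⟨w, hw⟩, hw' | ⟨α, hα⟩ | ⟨α, hα⟩⟩
      · exact Or.inl hw'.2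
      · exact Or.inr ⟨α, Or.inl hα.symm⟩
      · exact Or.inr ⟨α, Or.inr hα.symm⟩
    · rintro α s (hs | hs) i hi
      · simpa [hs, t] using hi
      · rw [mem_singleton_iff.1 hs] at hi
        simp only [y, Bool.and_eq_true, decide_eq_true_eq] at hi
        exact hi.2
    · have hlt := mk_Iio_toType_lt α
      refine lt_of_le_of_lt ?_ (Cardinal.add_lt_of_lt aleph0_lt_cardB.le hlt hlt)
      refine le_trans ?_ ((Cardinal.mk_union_le (t '' Iio α) (y '' Iio α)).trans
        (add_le_add Cardinal.mk_image_le Cardinal.mk_image_le))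
      refine Cardinal.mk_le_of_injective (f := fun s => ⟨((s.1 : guardedSequences) : ℕ → Bool), ?_⟩)
        fun s s' h => ?_
      · obtain ⟨s, hs⟩ := s
        simp only [mem_iUnion] at hs
        obtain ⟨β, hβ, hs | hs⟩ := hs
        · exact Or.inl ⟨β, hβ, hs.symm⟩
        · exact Or.inr ⟨β, hβ, (mem_singleton_iff.1 hs).symm⟩
      · exact Subtype.ext (Subtype.ext (Subtype.ext (Subtype.mk.inj h)))
  refine ⟨binaryReal '' Y, ?_, ?_, fun hadd => ?_⟩
  -- The tower is unbounded, so it has at least `𝔟` distinct members, and `t α` determines `f α`.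
  · have hcard : cardB ≤ #(range f) := by
      refine csInf_le' ⟨range f, range_subset_iff.2 hf, fun g _ => ?_, rfl⟩
      obtain ⟨α, hα⟩ := hunb g
      exact ⟨_, mem_range_self α, Nat.frequently_atTop_iff_infinite.1 hα⟩
    have hft : ∀ α β, t α = t β → f α = f β := by
      intro α β h
      refine (StrictMono.range_inj (hf α) (hf β)).1 (gapUnion_injective (Set.ext fun i => ?_))
      simpa [t, T] using congrFun h i
    rw [hpb, hYX, Cardinal.mk_image_eq isEmbedding_binaryReal_guardedSequences.injective]
    refine hcard.trans ?_
    have hYt : ∀ α, t α ∈ Y := fun α => Or.inr (Or.inl (mem_range_self α))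
    refine Cardinal.mk_le_of_injective
      (f := fun g : range f => (⟨⟨t g.2.choose, hY (hYt _)⟩, hYt _⟩ : Y')) fun g g' h => ?_
    have := hft _ _ (congrArg (fun s : Y' => ((s : guardedSequences) : ℕ → Bool)) h)
    rw [g.2.choose_spec, g'.2.choose_spec] at this
    exact Subtype.ext this
  · rw [hYX]
    exact (isEmbedding_binaryReal_guardedSequences.homeomorphImage Y').hasPropertyGamma hgamma
  · refine hz (cantorMeasure_eq_zero_of_volume_image (measure_mono_null ?_
      (hadd _ volume_image_vanishingSequences)))
    rintro _ ⟨_, ⟨α, rfl⟩, rfl⟩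
    -- The part of `z α` off `T α`; it vanishes on the blocks indexed by `range (f α)`.
    let w : ℕ → Bool := fun i => z α i && !decide (i ∈ T α)
    have hw : w ∈ vanishingSequences := by
      refine (Nat.frequently_atTop_iff_infinite.2
        (infinite_range_of_injective (hf α).injective)).mono fun n hn i hi => ?_
      have : i ∈ T α := mem_gapUnion.2 ⟨n, hn, hi⟩
      simp [w, this]
    refine mem_add.2 ⟨_, mem_image_of_mem _ (Or.inr (Or.inr (mem_range_self α))), _,
      mem_image_of_mem _ hw, (binaryReal_add (fun i => ?_) fun i => ?_).symm⟩
    · cases h1 : z α i <;> by_cases h2 : i ∈ T α <;> simp [y, w, h1, h2]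
    · by_cases h2 : i ∈ T α <;> simp [y, w, h2]
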